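/- Fix a disruption probability $p\in(0,1)$ and a recovery parameter $\zeta\in[0,1]$. An instance consists of $n\ge 1$ and a distribution function $F\in\mathcal F$, where $\mathcal F$ is the set of continuous distribution functions of laws on $[0,\infty)$ with finite mean that are strictly increasing where $0<F<1$. The values $X_1,\dots,X_n$ are i.i.d. with distribution $F$, and the disruption indicators $Y_1,\dots,Y_n$ are i.i.d. Bernoulli($p$), independent of the values. An adaptive algorithm $\mathtt{ALG}$ for $n$ values assigns to each $F\in\mathcal F$ thresholds $\tau_1\ge\cdots\ge\tau_n$ (real numbers). It observes $X_1,X_2,\dots$ in order and selects $X_i$ if and only if $X_i\ge\tau_i$. If $X_i$ is selected and $Y_i=0$, it gains $X_i$ and continues; if $X_i$ is selected and $Y_i=1$, it gains $\zeta X_i$ and the process stops. Let $v(\mathtt{ALG}(n,F))$ be its expected total gain. The clairvoyant benchmark is $$v(\mathtt{OPT}(n,F))=\mathbb E\Big[\max_{\sigma}\Big\{\sum_{i=1}^{\min\{D-1,n\}}X_{\sigma(i)}+\zeta\,\mathbb I\{D\le n\}\,X_{\sigma(D)}\Big\}\Big],$$ where $\sigma$ ranges over the permutations of $\{1,\dots,n\}$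 and $D$ is independent of the values with $\Pr[D=j]=p(1-p)^{j-1}$ for $j\ge1$. Put $$\gamma^{\mathrm{AD}}_{n,p,\zeta}=\sup_{\mathtt{ALG}}\ \inf_{F\in\mathcal F}\ \frac{v(\mathtt{ALG}(n,F))}{v(\mathtt{OPT}(n,F))},$$ the supremum being over adaptive algorithms for $n$ values. Theorem. The integral equation $\int_0^1\big(y-y\ln y+(\beta-1)\big)^{-1}\,\mathrm dy=1$ (the integrand being required to be integrable) has a unique real solution $\beta$. It is positive, and $\theta^*=1/\beta$ satisfies $\theta^*\approx 0.745$, in the sense that $|\theta^*-0.745|<0.0005$. For every $p\in(0,1)$ and every $\zeta\in[0,1]$, $$\liminf_{n\to\infty}\gamma^{\mathrm{AD}}_{n,p,\zeta}\ \ge\ \theta^*.$$ -/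

import Mathlib

open MeasureTheory ProbabilityTheory Filter

noncomputable section

namespace OSUD

/-- The value distributions `F`: probability laws on the non-negative reals whose cumulative
distribution function is continuous and increasing (strictly, as long as it is neither `0` nor
`1`), with finite mean, so that the values of all algorithms are finite. -/
structure ValueDist where
  /-- the law of a single value -/
  law : Measure ℝ
  isProbabilityMeasure : IsProbabilityMeasure law
  nonneg : law (Set.Iio 0) = 0
  continuous_cdf : Continuous fun x => cdf law x
  increasing_cdf : StrictMonoOn (fun x => cdf law x) {x | 0 < cdf law x ∧ cdf law x < 1}
  finite_mean : ∫⁻ x, ENNReal.ofReal x ∂law ≠ ⊤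

/-- The values `X₁, …, Xₙ`: independent with law `F`. -/
def valuesLaw (n : ℕ) (F : ValueDist) : Measure (Fin n → ℝ) :=
  Measure.pi fun _ => F.law

/-- The disruption indicators `Y₁, …, Yₙ`: independent, each `true` with probability `p`. -/
def disruptionLaw (n : ℕ) (p : unitInterval) : Measure (Fin n → Bool) :=
  Measure.pi fun _ => bernoulliMeasure true false p

/-- With thresholds `τ`, values `x` and disruption indicators `y`, the `i`-th value is observed:
no earlier value was both selected and disrupted. -/
def Observed {n : ℕ} (τ x : Fin n → ℝ) (y : Fin n → Bool) (i : Fin n) : Prop :=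
  ∀ j < i, ¬ (τ j ≤ x j ∧ y j = true)

open Classical in
/-- The total value collected by the threshold algorithm `τ` on a given realization: each value
that is observed and reaches its threshold is selected; it contributes `x i` if it causes no
disruption, and the fraction `ζ` of `x i` if it does. -/
def payoff {n : ℕ} (ζ : unitInterval) (τ x : Fin n → ℝ) (y : Fin n → Bool) : ℝ :=
  ∑ i, if Observed τ x y i ∧ τ i ≤ x i then (if y i = true then (ζ : ℝ) * x i else x i) else 0

/-- `v(ALG)`: the expected total value collected with the thresholds `τ`. -/
def algValue (n : ℕ) (p ζ : unitInterval) (F : ValueDist) (τ : Fin n → ℝ) : ENNReal :=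
  ∫⁻ ω, ENNReal.ofReal (payoff ζ τ ω.1 ω.2) ∂(valuesLaw n F).prod (disruptionLaw n p)

/-- The value collected when `x` is examined in the order `σ`, everything is selected, and the
`d`-th selection (`d ≥ 1`) is the one that is disrupted. -/
def orderedPayoff {n : ℕ} (ζ : unitInterval) (x : Fin n → ℝ) (d : ℕ)
    (σ : Equiv.Perm (Fin n)) : ℝ :=
  ∑ i : Fin n, if (i : ℕ) + 1 < d then x (σ i)
    else if (i : ℕ) + 1 = d then (ζ : ℝ) * x (σ i) else 0

/-- `v(OPT)`: the expected value of the best order. The disruption time `D` is independent of the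
values and `D - 1` has the geometric law on `{0, 1, …}`, that is
`Pr[D = k + 1] = p * (1 - p) ^ k`. -/
def optValue (n : ℕ) (p ζ : unitInterval) (F : ValueDist) : ENNReal :=
  ∫⁻ ω, (⨆ σ : Equiv.Perm (Fin n), ENNReal.ofReal (orderedPayoff ζ ω.1 (ω.2 + 1) σ))
    ∂(valuesLaw n F).prod (geometricMeasure p)

/-- Adaptive algorithms for `n` values: knowing the distribution `F`, the algorithm fixes
thresholds `τ₁ ≥ ⋯ ≥ τₙ`. -/
structure AdaptiveAlg (n : ℕ) where
  /-- the thresholds used on the instance `(n, F)` -/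
  threshold : ValueDist → Fin n → ℝ
  antitone : ∀ F, Antitone (threshold F)

/-- The best competitive ratio of adaptive algorithms on instances with `n` values. -/
def adaptiveRatio (n : ℕ) (p ζ : unitInterval) : ENNReal :=
  ⨆ A : AdaptiveAlg n, ⨅ F : ValueDist,
    algValue n p ζ F (A.threshold F) / optValue n p ζ F

/-- `β` solves the integral equation `∫₀¹ (y - y ln y + (β - 1))⁻¹ dy = 1`. -/
def SolvesHillKertz (β : ℝ) : Prop :=
  IntervalIntegrable (fun y : ℝ => (y - y * Real.log y + (β - 1))⁻¹) volume 0 1 ∧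
    ∫ y in (0 : ℝ)..1, (y - y * Real.log y + (β - 1))⁻¹ = 1

end OSUD

end

noncomputable section

namespace OSUD

open Real Set Topology

/-! Write G(y) = y - y ln y, S for the tail of F, n = N + 1 and h = 1/N. Both values carry the same
factor 1 - p + pζ, so ζ cancels. Up to this factor the algorithm earns Σ_k ∏_{j<k} (1 - p S(τ_j))
R(τ_k), where R(t) is the expectation of X on {X ≥ t} (`algValue_eq`). The clairvoyant earns at most
n E[X (1 - p S(X))^N] ≤ n E[X exp(-p S(X)/h)] (`optValue_le`), because it sorts the values and the
value of rank r survives with probability (1 - p)^r.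

Let y_k be the Euler scheme of step h for y' = -(G(y) + β - 1), y(0) = 1, with gaps d_k = y_k -
y_{k+1}. The Hill–Kertz equation says that the exact flow needs time 1 to reach 0. G increases, so
each Euler step uses the largest speed on its interval, and y_N = 0 (`eulerSeq_eq_zero`). Cut the
discount exp(-p S/h) ∈ (0, 1] at the levels y_k. As S(X) dominates a uniform variable, the k-th
slice has mean at most (h/p)(G(y_k) - G(y_{k+1})) = d_k q_k / p, where q_k is h times the slope of G
over the gap (`integral_slice_le`). Let τ_k have selection probability q_k / p, or be 0 if that is
out of reach. Among weights bounded by d_k with such a mean, the top values are best, so the slice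
contributes at most d_k R(τ_k) (`integral_mul_slice_le`).

The scheme also gives d_0 ≤ hβ and d_{k+1} ≤ d_k (1 - q_k) before absorption. Hence d_k is at most
hβ times the survival probability of the algorithm (`eulerSeq_gap_le_prod`). Summing the slices
bounds OPT by (n/N) β ALG, and n/N tends to 1. Concavity of G makes q_k increase, so the thresholds
decrease. -/

/-! ### The Hill–Kertz equation: admissible parameters and uniqueness -/

/-- The function `y - y ln y` of the Hill–Kertz integral equation. -/
def entropyDrift (y : ℝ) : ℝ := y - y * Real.log y

lemma entropyDrift_zero : entropyDrift 0 = 0 := by simp [entropyDrift]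

lemma entropyDrift_one : entropyDrift 1 = 1 := by simp [entropyDrift]

lemma continuous_entropyDrift : Continuous entropyDrift :=
  continuous_id.sub Real.continuous_mul_log

lemma hasDerivAt_entropyDrift {y : ℝ} (hy : y ≠ 0) :
    HasDerivAt entropyDrift (-Real.log y) y := by
  convert! (hasDerivAt_id y).sub (Real.hasDerivAt_mul_log hy) using 1
  ring

lemma strictMonoOn_entropyDrift : StrictMonoOn entropyDrift (Icc 0 1) := by
  refine strictMonoOn_of_deriv_pos (convex_Icc 0 1) continuous_entropyDrift.continuousOn ?_
  intro y hy
  rw [interior_Icc] at hy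
  rw [(hasDerivAt_entropyDrift hy.1.ne').deriv]
  linarith [Real.log_neg hy.1 hy.2]

lemma entropyDrift_nonneg {y : ℝ} (hy : y ∈ Icc (0 : ℝ) 1) : 0 ≤ entropyDrift y := by
  rw [← entropyDrift_zero]
  exact strictMonoOn_entropyDrift.monotoneOn (left_mem_Icc.2 zero_le_one) hy hy.1

lemma entropyDrift_le_one {y : ℝ} (hy : y ∈ Icc (0 : ℝ) 1) : entropyDrift y ≤ 1 := by
  rw [← entropyDrift_one]
  exact strictMonoOn_entropyDrift.monotoneOn hy (right_mem_Icc.2 zero_le_one) hy.2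

lemma solvesHillKertz_iff (β : ℝ) : SolvesHillKertz β ↔
    IntervalIntegrable (fun y : ℝ => (entropyDrift y + (β - 1))⁻¹) volume 0 1 ∧
      ∫ y in (0 : ℝ)..1, (entropyDrift y + (β - 1))⁻¹ = 1 := Iff.rfl

lemma continuousOn_inv_entropyDrift {β : ℝ} (hβ : 1 < β) :
    ContinuousOn (fun y : ℝ => (entropyDrift y + (β - 1))⁻¹) (Icc 0 1) := by
  refine ContinuousOn.inv₀ (continuous_entropyDrift.add continuous_const).continuousOn ?_
  intro y hy
  have := entropyDrift_nonneg hy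
  linarith

/-- Differentiability at c makes the difference O(y - c), so its inverse is at least of the order of
the non-integrable 1/(y - c). This excludes 0 < β < 1. -/
lemma not_intervalIntegrable_inv_entropyDrift_sub {c : ℝ} (hc : c ∈ Ioo (0 : ℝ) 1) :
    ¬ IntervalIntegrable (fun y : ℝ => (entropyDrift y - entropyDrift c)⁻¹) volume 0 1 := by
  refine not_intervalIntegrable_of_sub_inv_isBigO_punctured (c := c) ?_ zero_ne_one
    (by rw [uIcc_of_le zero_le_one]; exact Ioo_subset_Icc_self hc)
  refine Asymptotics.IsBigO.inv_rev
    ((hasDerivAt_entropyDrift hc.1.ne').isBigO_sub.mono nhdsWithin_le_nhds) ?_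
  have h1 : ∀ᶠ y in 𝓝[≠] c, y ∈ Ioo (0 : ℝ) 1 :=
    nhdsWithin_le_nhds (isOpen_Ioo.mem_nhds hc)
  filter_upwards [h1, self_mem_nhdsWithin] with y hy hyc h
  exact absurd (strictMonoOn_entropyDrift.injOn (Ioo_subset_Icc_self hy) (Ioo_subset_Icc_self hc)
    (sub_eq_zero.1 h)) hyc

/-- The integrand 1/(y (1 - ln y)) is, up to sign, the derivative of ln(1 - ln y), which is
unbounded at 0. This excludes β = 1. -/
lemma not_intervalIntegrable_inv_entropyDrift :
    ¬ IntervalIntegrable (fun y : ℝ => (entropyDrift y)⁻¹) volume 0 1 := by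
  have hpos : ∀ᶠ y in 𝓝[>] (0 : ℝ), y ∈ Ioo (0 : ℝ) 1 := Ioo_mem_nhdsGT zero_lt_one
  have hd : ∀ y ∈ Ioo (0 : ℝ) 1,
      HasDerivAt (fun y => Real.log (1 - Real.log y)) (-(y⁻¹) / (1 - Real.log y)) y := by
    intro y hy
    have := Real.log_neg hy.1 hy.2
    exact ((Real.hasDerivAt_log hy.1.ne').const_sub 1).log (by linarith)
  refine not_intervalIntegrable_of_tendsto_norm_atTop_of_deriv_isBigO_filter
    (f := fun y => Real.log (1 - Real.log y)) (𝓝[>] (0 : ℝ)) ?_ ?_ ?_ ?_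
  · rw [uIcc_of_le zero_le_one]
    exact Icc_mem_nhdsGT zero_lt_one
  · filter_upwards [hpos] with y hy using (hd y hy).differentiableAt
  · refine tendsto_norm_atTop_atTop.comp (Real.tendsto_log_atTop.comp ?_)
    exact tendsto_atTop_add_const_left _ 1
      (tendsto_neg_atBot_atTop.comp Real.tendsto_log_nhdsGT_zero)
  · refine Asymptotics.IsBigO.of_bound 1 ?_
    filter_upwards [hpos] with y hy
    rw [(hd y hy).deriv, one_mul]
    refine le_of_eq ?_
    have : entropyDrift y = y * (1 - Real.log y) := by rw [entropyDrift]; ring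
    rw [this, neg_div, norm_neg, mul_inv, div_eq_mul_inv]

lemma SolvesHillKertz.one_lt {β : ℝ} (h : SolvesHillKertz β) : 1 < β := by
  rw [solvesHillKertz_iff] at h
  obtain ⟨hi, h⟩ := h
  by_contra! hβ
  rcases le_or_gt β 0 with h0 | h0
  · have : 0 ≤ ∫ y in (0 : ℝ)..1, -(entropyDrift y + (β - 1))⁻¹ := by
      refine intervalIntegral.integral_nonneg zero_le_one fun y hy => ?_
      have := entropyDrift_le_one hy
      rw [neg_nonneg, inv_nonpos]
      linarith
    rw [intervalIntegral.integral_neg, h] at this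
    norm_num at this
  rcases hβ.lt_or_eq with h1 | rfl
  · obtain ⟨c, hc, hc'⟩ : 1 - β ∈ entropyDrift '' Ioo 0 1 := by
      refine intermediate_value_Ioo zero_le_one continuous_entropyDrift.continuousOn ?_
      rw [entropyDrift_zero, entropyDrift_one]
      constructor <;> linarith
    refine not_intervalIntegrable_inv_entropyDrift_sub hc ?_
    convert hi using 3
    rw [hc']; ring
  · refine not_intervalIntegrable_inv_entropyDrift ?_
    simpa using hi

lemma SolvesHillKertz.unique {β γ : ℝ} (hβ : SolvesHillKertz β) (hγ : SolvesHillKertz γ) :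
    β = γ := by
  by_contra hne
  wlog hlt : β < γ generalizing β γ
  · exact this hγ hβ (Ne.symm hne) (lt_of_le_of_ne (not_lt.1 hlt) (Ne.symm hne))
  have h1 := hβ.one_lt
  have key : ∫ y in (0 : ℝ)..1, (entropyDrift y + (γ - 1))⁻¹ <
      ∫ y in (0 : ℝ)..1, (entropyDrift y + (β - 1))⁻¹ := by
    have hpt : ∀ y ∈ Icc (0 : ℝ) 1,
        (entropyDrift y + (γ - 1))⁻¹ < (entropyDrift y + (β - 1))⁻¹ := by
      intro y hy
      have := entropyDrift_nonneg hy
      exact inv_strictAnti₀ (by linarith) (by linarith)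
    exact intervalIntegral.integral_lt_integral_of_continuousOn_of_le_of_exists_lt zero_lt_one
      (continuousOn_inv_entropyDrift (h1.trans hlt)) (continuousOn_inv_entropyDrift h1)
      (fun y hy => (hpt y (Ioc_subset_Icc_self hy)).le)
      ⟨0, by simp, hpt 0 (by simp)⟩
  rw [(solvesHillKertz_iff _).1 hγ |>.2, (solvesHillKertz_iff _).1 hβ |>.2] at key
  exact lt_irrefl _ key

/-- The solution lies between any two parameters at which the integral is above and below `1`. -/
lemma exists_solvesHillKertz {a b : ℝ} (ha : 1 < a) (hab : a ≤ b)
    (hIa : 1 ≤ ∫ y in (0 : ℝ)..1, (entropyDrift y + (a - 1))⁻¹)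
    (hIb : ∫ y in (0 : ℝ)..1, (entropyDrift y + (b - 1))⁻¹ ≤ 1) :
    ∃ β ∈ Icc a b, SolvesHillKertz β := by
  -- Truncating the denominator below by a - 1 changes nothing on [0, 1] but makes the integrand
  -- jointly continuous everywhere, so continuity in β is available.
  have heq : ∀ β ∈ Icc a b, ∫ y in (0 : ℝ)..1, (entropyDrift y + (β - 1))⁻¹ =
      ∫ y in (0 : ℝ)..1, (max (entropyDrift y + (β - 1)) (a - 1))⁻¹ := by
    intro β hβ
    refine intervalIntegral.integral_congr fun y hy => ?_
    rw [uIcc_of_le zero_le_one] at hy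
    have := entropyDrift_nonneg hy
    rw [max_eq_left (by linarith [hβ.1])]
  have hcont : Continuous fun β : ℝ =>
      ∫ y in (0 : ℝ)..1, (max (entropyDrift y + (β - 1)) (a - 1))⁻¹ := by
    refine intervalIntegral.continuous_parametric_intervalIntegral_of_continuous' ?_ 0 1
    refine Continuous.inv₀ ?_ fun q => ?_
    · have := continuous_entropyDrift
      fun_prop
    · have := le_max_right (entropyDrift q.2 + (q.1 - 1)) (a - 1)
      have : 0 < a - 1 := by linarith
      exact (by linarith : 0 < max (entropyDrift q.2 + (q.1 - 1)) (a - 1)).ne'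
  rw [heq a (left_mem_Icc.2 hab)] at hIa
  rw [heq b (right_mem_Icc.2 hab)] at hIb
  obtain ⟨β, hβ, h⟩ := intermediate_value_Icc' hab hcont.continuousOn ⟨hIb, hIa⟩
  refine ⟨β, hβ, (solvesHillKertz_iff β).2 ⟨?_, by rw [heq β hβ]; exact h⟩⟩
  refine ContinuousOn.intervalIntegrable ?_
  rw [uIcc_of_le zero_le_one]
  exact continuousOn_inv_entropyDrift (ha.trans_le hβ.1)

/-! ### Numerical enclosure of β -/

/-- Integration by parts: y^(a+1) (y ln y)^(b+1) vanishes at both ends, and its derivative links (a,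
b+1) to (a+1, b). Powers of y ln y rather than of ln y keep everything continuous at 0. -/
lemma integral_pow_mul_mul_log_pow (a b : ℕ) :
    ∫ y in (0 : ℝ)..1, y ^ a * (y * Real.log y) ^ b =
      (-1) ^ b * (b.factorial : ℝ) / ((a : ℝ) + b + 1) ^ (b + 1) := by
  induction b generalizing a with
  | zero => simp
  | succ b ih =>
    have hM := Real.continuous_mul_log
    have hd : ∀ y ∈ Ioo (0 : ℝ) 1,
        HasDerivAt (fun y : ℝ => y ^ (a + 1) * (y * Real.log y) ^ (b + 1))
          (((a : ℝ) + b + 2) * (y ^ a * (y * Real.log y) ^ (b + 1)) +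
            ((b : ℝ) + 1) * (y ^ (a + 1) * (y * Real.log y) ^ b)) y := by
      intro y hy
      convert! (hasDerivAt_pow (a + 1) y).mul ((Real.hasDerivAt_mul_log hy.1.ne').pow (b +
        1)) using 1
      push_cast
      rw [Pi.pow_apply]
      ring
    have hc : ∀ i j : ℕ, Continuous fun y : ℝ => y ^ i * (y * Real.log y) ^ j :=
      fun i j => (continuous_pow i).mul (hM.pow j)
    have hint := intervalIntegral.integral_eq_sub_of_hasDerivAt_of_le zero_le_one
      (hc (a + 1) (b + 1)).continuousOn hd
      ((((hc a (b + 1)).const_mul _).add ((hc (a + 1) b).const_mul _)).intervalIntegrable 0 1)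
    rw [intervalIntegral.integral_add (((hc a (b + 1)).const_mul _).intervalIntegrable 0 1)
      (((hc (a + 1) b).const_mul _).intervalIntegrable 0 1),
      intervalIntegral.integral_const_mul, intervalIntegral.integral_const_mul, ih] at hint
    simp only [Real.log_one, mul_zero, zero_mul, ne_eq, Nat.succ_ne_zero,
      not_false_eq_true, zero_pow, sub_zero] at hint
    rw [Nat.factorial_succ]
    push_cast at hint ⊢
    have h2 : ((a : ℝ) + 1 + b + 1) = a + b + 2 := by ring
    have h3 : ((a : ℝ) + (b + 1) + 1) = a + b + 2 := by ring
    have hpos : (0 : ℝ) < a + b + 2 := by positivity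
    rw [h2] at hint
    rw [h3, eq_div_iff (by positivity), pow_succ ((a : ℝ) + b + 2) (b + 1)]
    field_simp at hint
    linear_combination hint

/-- Integrals of polynomials in `y` and `y ln y`, given by their lists of terms. -/
lemma integral_sum_pow_mul_mul_log_pow (l : List (ℝ × ℕ × ℕ)) :
    ∫ y in (0 : ℝ)..1, (l.map fun t => t.1 * (y ^ t.2.1 * (y * Real.log y) ^ t.2.2)).sum =
      (l.map fun t => t.1 * ((-1) ^ t.2.2 * (t.2.2.factorial : ℝ) /
        ((t.2.1 : ℝ) + t.2.2 + 1) ^ (t.2.2 + 1))).sum := by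
  have hc : ∀ t : ℝ × ℕ × ℕ,
      Continuous fun y : ℝ => t.1 * (y ^ t.2.1 * (y * Real.log y) ^ t.2.2) :=
    fun t => ((continuous_pow t.2.1).mul (Real.continuous_mul_log.pow t.2.2)).const_mul _
  induction l with
  | nil => simp
  | cons t l ih =>
    simp only [List.map_cons, List.sum_cons]
    rw [intervalIntegral.integral_add ((hc t).intervalIntegrable 0 1)
      ((continuous_list_sum l fun t _ => hc t).intervalIntegrable 0 1), ih,
      intervalIntegral.integral_const_mul, integral_pow_mul_mul_log_pow]

/-- A Newton step for the reciprocal, whose error (1 - qg)²/g is non-negative. With q a polynomial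
in y and y ln y, the left side integrates in closed form. -/
lemma two_mul_sub_sq_mul_le_inv {g : ℝ} (hg : 0 < g) (q : ℝ) : 2 * q - q ^ 2 * g ≤ g⁻¹ := by
  have : g⁻¹ - (2 * q - q ^ 2 * g) = (1 - q * g) ^ 2 * g⁻¹ := by field_simp; ring
  nlinarith [mul_nonneg (sq_nonneg (1 - q * g)) (inv_pos.2 hg).le]

lemma inv_le_two_mul_sub_sq_mul_add {c g : ℝ} (hc : 0 < c) (hg : c ≤ g) (q : ℝ) :
    g⁻¹ ≤ 2 * q - q ^ 2 * g + (1 - q * g) ^ 2 / c := by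
  have hg0 := hc.trans_le hg
  have : g⁻¹ - (2 * q - q ^ 2 * g) = (1 - q * g) ^ 2 / g := by field_simp; ring
  have := div_le_div_of_nonneg_left (sq_nonneg (1 - q * g)) hc hg
  linarith

lemma one_le_integral_inv_entropyDrift :
    1 ≤ ∫ y in (0 : ℝ)..1, (entropyDrift y + (1.3414 - 1))⁻¹ := by
  -- Expansion of 2q - q²g, where g is the denominator and q the approximation to 1/g given at the
  -- end of the proof; the closing `ring` checks it.
  let l : List (ℝ × ℕ × ℕ) := [(9153397/3125000, 0, 0), (-10449107/1250000, 1, 0),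
    (3366024/390625, 0, 1), (-20153202811/50000000, 2, 0), (-243763657/1250000, 1, 1),
    (-4710774371/25000000, 3, 0), (4943666/390625, 0, 2), (-13496758649/25000000, 2, 1),
    (147902023/312500, 1, 2), (59338821827/50000000, 4, 0), (-35578483253/25000000, 3, 1),
    (-503991787/2000000, 2, 2), (-5358222721/25000000, 5, 0), (7316742397/5000000, 4, 1),
    (132496/625, 0, 3), (85722/125, 1, 3), (-17963467/10000, 3, 2),
    (-16281851507/50000000, 6, 0), (1597579/2500, 5, 1), (221841/400, 2, 3),
    (-330171/1000, 4, 2), (-491401/10000, 7, 0), (491401/10000, 6, 1)]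
  have hval : 1 ≤ ∫ y in (0 : ℝ)..1,
      (l.map fun t => t.1 * (y ^ t.2.1 * (y * Real.log y) ^ t.2.2)).sum := by
    rw [integral_sum_pow_mul_mul_log_pow]
    norm_num [l, Nat.factorial]
  refine hval.trans (intervalIntegral.integral_mono_on zero_le_one ?_ ?_ fun y hy => ?_)
  · refine Continuous.intervalIntegrable (continuous_list_sum l fun t _ => ?_) _ _
    exact ((continuous_pow t.2.1).mul (Real.continuous_mul_log.pow t.2.2)).const_mul _
  · refine ContinuousOn.intervalIntegrable ?_
    rw [uIcc_of_le zero_le_one]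
    exact continuousOn_inv_entropyDrift (by norm_num)
  · have h0 := entropyDrift_nonneg hy
    refine le_trans (le_of_eq ?_) (two_mul_sub_sq_mul_le_inv (by linarith)
      ((73/25) * y ^ 0 * (y * Real.log y) ^ 0 + (537/20) * y ^ 1 * (y * Real.log y) ^ 0 +
        (364/25) * y ^ 0 * (y * Real.log y) ^ 1 + (-2203/100) * y ^ 2 * (y * Real.log y) ^ 0 +
        (471/20) * y ^ 1 * (y * Real.log y) ^ 1 + (-701/100) * y ^ 3 * (y * Real.log y) ^ 0))
    simp only [l, List.map_cons, List.map_nil, List.sum_cons, List.sum_nil, entropyDrift]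
    ring

lemma integral_inv_entropyDrift_le_one :
    ∫ y in (0 : ℝ)..1, (entropyDrift y + (1.343 - 1))⁻¹ ≤ 1 := by
  -- Expansion of 2q - q²g + (1 - qg)²/c, with c = 0.343 the minimum of g on [0, 1].
  let l : List (ℝ × ℕ × ℕ) := [(1000/343, 0, 0), (-28644913/3430000, 1, 0),
    (28644913/3430000, 0, 1), (29611499/1715000, 2, 0), (-68094289/1715000, 1, 1),
    (3848279/171500, 0, 2), (112447911/3430000, 3, 0), (104747429/3430000, 2, 1),
    (-4784763/42875, 1, 2), (-12288714/214375, 4, 0), (50383433/428750, 3, 1),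
    (33793/700, 0, 3), (-3593201/85750, 2, 2), (-770731/30625, 5, 0), (-1237769/30625, 4, 1),
    (-618/7, 1, 3), (41548/245, 3, 2), (70/1, 0, 4), (-104/1, 2, 3), (1352/35, 6, 0),
    (-2704/35, 5, 1), (1352/35, 4, 2)]
  have hval : ∫ y in (0 : ℝ)..1,
      (l.map fun t => t.1 * (y ^ t.2.1 * (y * Real.log y) ^ t.2.2)).sum ≤ 1 := by
    rw [integral_sum_pow_mul_mul_log_pow]
    norm_num [l, Nat.factorial]
  refine le_trans (intervalIntegral.integral_mono_on zero_le_one ?_ ?_ fun y hy => ?_) hval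
  · refine ContinuousOn.intervalIntegrable ?_
    rw [uIcc_of_le zero_le_one]
    exact continuousOn_inv_entropyDrift (by norm_num)
  · refine Continuous.intervalIntegrable (continuous_list_sum l fun t _ => ?_) _ _
    exact ((continuous_pow t.2.1).mul (Real.continuous_mul_log.pow t.2.2)).const_mul _
  · have h0 := entropyDrift_nonneg hy
    refine (inv_le_two_mul_sub_sq_mul_add (c := 1.343 - 1) (by norm_num) (by linarith)
      ((253/100) * y ^ 0 * (y * Real.log y) ^ 0 + (181/100) * y ^ 1 * (y * Real.log y) ^ 0 +
        (49/10) * y ^ 0 * (y * Real.log y) ^ 1 +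
        (-91/25) * y ^ 2 * (y * Real.log y) ^ 0)).trans (le_of_eq ?_)
    simp only [l, List.map_cons, List.map_nil, List.sum_cons, List.sum_nil, entropyDrift]
    ring

lemma exists_solvesHillKertz_mem : ∃ β ∈ Icc (1.3414 : ℝ) 1.343, SolvesHillKertz β :=
  exists_solvesHillKertz (by norm_num) (by norm_num) one_le_integral_inv_entropyDrift
    integral_inv_entropyDrift_le_one

/-! ### The Euler scheme -/

lemma concaveOn_entropyDrift : ConcaveOn ℝ (Ici 0) entropyDrift := by
  have h := (concaveOn_id (𝕜 := ℝ) (convex_Ici (0 : ℝ))).add Real.concaveOn_negMulLog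
  convert! h using 1
  ext y
  simp [entropyDrift, Real.negMulLog, sub_eq_add_neg]

/-- The Euler scheme with step `h` for `y' = -(y - y ln y + (β - 1))`, `y 0 = 1`, absorbed
at `0`. -/
def eulerSeq (h β : ℝ) : ℕ → ℝ
  | 0 => 1
  | k + 1 => max 0 (eulerSeq h β k - h * (entropyDrift (eulerSeq h β k) + (β - 1)))

section Euler

variable {h β : ℝ}

lemma eulerSeq_succ (k : ℕ) : eulerSeq h β (k + 1) =
    max 0 (eulerSeq h β k - h * (entropyDrift (eulerSeq h β k) + (β - 1))) := rfl

lemma eulerSeq_nonneg (k : ℕ) : 0 ≤ eulerSeq h β k := by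
  cases k with
  | zero => exact zero_le_one
  | succ k => exact le_max_left _ _

lemma eulerSeq_mem_Icc (hh : 0 < h) (hβ : 1 < β) (k : ℕ) : eulerSeq h β k ∈ Icc (0 : ℝ) 1 := by
  refine ⟨eulerSeq_nonneg k, ?_⟩
  induction k with
  | zero => exact le_rfl
  | succ k ih =>
    have hG := entropyDrift_nonneg ⟨eulerSeq_nonneg k, ih⟩
    have : 0 ≤ h * (entropyDrift (eulerSeq h β k) + (β - 1)) := by
      apply mul_nonneg hh.le; linarith
    exact max_le zero_le_one (by linarith)

lemma eulerSeq_speed_pos (hh : 0 < h) (hβ : 1 < β) (k : ℕ) :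
    0 < h * (entropyDrift (eulerSeq h β k) + (β - 1)) := by
  have hG := entropyDrift_nonneg (eulerSeq_mem_Icc hh hβ k)
  apply mul_pos hh; linarith

lemma eulerSeq_antitone (hh : 0 < h) (hβ : 1 < β) : Antitone (eulerSeq h β) := by
  refine antitone_nat_of_succ_le fun k => ?_
  have := eulerSeq_speed_pos hh hβ k
  exact max_le (eulerSeq_nonneg k) (by linarith)

lemma eulerSeq_succ_lt (hh : 0 < h) (hβ : 1 < β) {k : ℕ} (hk : 0 < eulerSeq h β k) :
    eulerSeq h β (k + 1) < eulerSeq h β k := by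
  have := eulerSeq_speed_pos hh hβ k
  exact max_lt hk (by linarith)

lemma eulerSeq_sub_succ {k : ℕ} (hk : 0 < eulerSeq h β (k + 1)) :
    eulerSeq h β k - eulerSeq h β (k + 1) =
      h * (entropyDrift (eulerSeq h β k) + (β - 1)) := by
  rw [eulerSeq_succ] at hk ⊢
  rw [max_eq_right (by by_contra! hc; rw [max_eq_left hc.le] at hk; exact lt_irrefl _ hk)]
  ring

lemma eulerSeq_sub_succ_le (k : ℕ) :
    eulerSeq h β k - eulerSeq h β (k + 1) ≤
      h * (entropyDrift (eulerSeq h β k) + (β - 1)) := by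
  have := le_max_right 0 (eulerSeq h β k - h * (entropyDrift (eulerSeq h β k) + (β - 1)))
  rw [← eulerSeq_succ] at this
  linarith

/-- The gap of the Euler scheme shrinks at the rate given by the drift. -/
lemma eulerSeq_gap_succ_le {k : ℕ} (hk : 0 < eulerSeq h β (k + 1)) :
    eulerSeq h β (k + 1) - eulerSeq h β (k + 2) ≤
      (eulerSeq h β k - eulerSeq h β (k + 1)) -
        h * (entropyDrift (eulerSeq h β k) - entropyDrift (eulerSeq h β (k + 1))) := by
  rw [eulerSeq_sub_succ hk]
  have := eulerSeq_sub_succ_le (h := h) (β := β) (k + 1)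
  linarith

/-- The integral is the time the exact flow takes from 1 down to y_k. On each step the speed is at
most its value at the upper end, which is the Euler speed, so the flow needs at least h. -/
lemma mul_le_integral_eulerSeq (hh : 0 < h) (hβ : 1 < β) {k : ℕ} (hk : 0 < eulerSeq h β k) :
    k * h ≤ ∫ y in (eulerSeq h β k)..1, (entropyDrift y + (β - 1))⁻¹ := by
  induction k with
  | zero => simp [eulerSeq]
  | succ k ih =>
    have hlt := eulerSeq_antitone hh hβ (Nat.le_succ k)
    have hk' := hk.trans_le hlt
    have hm := eulerSeq_mem_Icc hh hβ k
    have hm' := eulerSeq_mem_Icc hh hβ (k + 1)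
    have hint : ∀ a ∈ Icc (0 : ℝ) 1, ∀ b ∈ Icc (0 : ℝ) 1,
        IntervalIntegrable (fun y => (entropyDrift y + (β - 1))⁻¹) volume a b := fun a ha b hb =>
      ((continuousOn_inv_entropyDrift hβ).mono (uIcc_subset_Icc ha hb)).intervalIntegrable
    rw [← intervalIntegral.integral_add_adjacent_intervals (hint _ hm' _ hm)
      (hint _ hm _ (right_mem_Icc.2 zero_le_one))]
    have hG : 0 < entropyDrift (eulerSeq h β k) + (β - 1) := by
      have := entropyDrift_nonneg hm; linarith
    have hstep : h ≤ ∫ y in (eulerSeq h β (k + 1))..(eulerSeq h β k),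
        (entropyDrift y + (β - 1))⁻¹ := by
      have hconst : ∫ _ in (eulerSeq h β (k + 1))..(eulerSeq h β k),
          (entropyDrift (eulerSeq h β k) + (β - 1))⁻¹ = h := by
        rw [intervalIntegral.integral_const, eulerSeq_sub_succ hk, smul_eq_mul, mul_assoc,
          mul_inv_cancel₀ hG.ne', mul_one]
      refine hconst.symm.le.trans (intervalIntegral.integral_mono_on hlt (by simp)
        (hint _ hm' _ hm) fun y hy => ?_)
      have hy' : y ∈ Icc (0 : ℝ) 1 := ⟨hm'.1.trans hy.1, hy.2.trans hm.2⟩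
      have h0 := entropyDrift_nonneg hy'
      exact inv_anti₀ (by linarith)
        (by linarith [strictMonoOn_entropyDrift.monotoneOn hy' hm hy.2])
    have := ih hk'
    push_cast
    linarith

/-- With the Hill–Kertz parameter the Euler scheme of step `1 / N` is absorbed within `N` steps. -/
lemma eulerSeq_eq_zero (hβ : SolvesHillKertz β) {N : ℕ} (hN : 0 < N) :
    eulerSeq (1 / N) β N = 0 := by
  have h1 := hβ.one_lt
  have hh : (0 : ℝ) < 1 / N := by positivity
  by_contra hne
  have hpos : 0 < eulerSeq (1 / N) β N := lt_of_le_of_ne (eulerSeq_nonneg _) (Ne.symm hne)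
  have hm := eulerSeq_mem_Icc hh h1 N
  have hle := mul_le_integral_eulerSeq hh h1 hpos
  rw [mul_one_div_cancel (by positivity)] at hle
  have hint : ∀ a ∈ Icc (0 : ℝ) 1, ∀ b ∈ Icc (0 : ℝ) 1,
      IntervalIntegrable (fun y => (entropyDrift y + (β - 1))⁻¹) volume a b := fun a ha b hb =>
    ((continuousOn_inv_entropyDrift h1).mono (uIcc_subset_Icc ha hb)).intervalIntegrable
  have htot := ((solvesHillKertz_iff β).1 hβ).2
  rw [← intervalIntegral.integral_add_adjacent_intervals
    (hint _ (left_mem_Icc.2 zero_le_one) _ hm) (hint _ hm _ (right_mem_Icc.2 zero_le_one))] at htot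
  -- The time still needed below y_N would push the total above 1.
  have : 0 < ∫ y in (0 : ℝ)..(eulerSeq (1 / N) β N), (entropyDrift y + (β - 1))⁻¹ := by
    refine intervalIntegral.intervalIntegral_pos_of_pos_on
      (hint _ (left_mem_Icc.2 zero_le_one) _ hm) (fun y hy => ?_) hpos
    have := entropyDrift_nonneg ⟨hy.1.le, hy.2.le.trans hm.2⟩
    exact inv_pos.2 (by linarith)
  linarith

/-- The expected quantile of the `k`-th step: `h` times the slope of the drift over the gap. -/
def eulerQuantile (h β : ℝ) (k : ℕ) : ℝ :=
  h * ((entropyDrift (eulerSeq h β k) - entropyDrift (eulerSeq h β (k + 1))) /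
    (eulerSeq h β k - eulerSeq h β (k + 1)))

lemma eulerQuantile_mul (hh : 0 < h) (hβ : 1 < β) {k : ℕ} (hk : 0 < eulerSeq h β k) :
    eulerQuantile h β k * (eulerSeq h β k - eulerSeq h β (k + 1)) =
      h * (entropyDrift (eulerSeq h β k) - entropyDrift (eulerSeq h β (k + 1))) := by
  have := sub_pos.2 (eulerSeq_succ_lt hh hβ hk)
  rw [eulerQuantile, mul_assoc, div_mul_cancel₀ _ this.ne']

lemma eulerQuantile_pos (hh : 0 < h) (hβ : 1 < β) {k : ℕ} (hk : 0 < eulerSeq h β k) :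
    0 < eulerQuantile h β k := by
  have hlt := eulerSeq_succ_lt hh hβ hk
  exact mul_pos hh (div_pos (sub_pos.2 (strictMonoOn_entropyDrift (eulerSeq_mem_Icc hh hβ _)
    (eulerSeq_mem_Icc hh hβ _) hlt)) (sub_pos.2 hlt))

/-- Chord slopes of the concave G grow as the points descend. -/
lemma eulerQuantile_le_succ (hh : 0 < h) (hβ : 1 < β) {k : ℕ} (hk : 0 < eulerSeq h β (k + 1)) :
    eulerQuantile h β k ≤ eulerQuantile h β (k + 1) :=
  mul_le_mul_of_nonneg_left (concaveOn_entropyDrift.slope_anti_adjacent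
    (eulerSeq_nonneg (k + 2)) (eulerSeq_nonneg k) (eulerSeq_succ_lt hh hβ hk)
    (eulerSeq_succ_lt hh hβ (hk.trans_le (eulerSeq_antitone hh hβ (Nat.le_succ k))))) hh.le

end Euler

/-! ### The value of a threshold algorithm -/

lemma lintegral_pi_prod {ι : Type*} [Fintype ι] {Ω : ι → Type*} [∀ i, MeasurableSpace (Ω i)]
    (μ : ∀ i, Measure (Ω i)) [∀ i, IsProbabilityMeasure (μ i)] {f : ∀ i, Ω i → ENNReal}
    (hf : ∀ i, Measurable (f i)) :
    ∫⁻ x, ∏ i, f i (x i) ∂Measure.pi μ = ∏ i, ∫⁻ a, f i a ∂μ i := by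
  refine (lintegral_prod_eq_prod_lintegral_of_indepFun Finset.univ
    (fun i (x : ∀ i, Ω i) => f i (x i))
    (iIndepFun_pi fun i => (hf i).aemeasurable)
    fun i => (hf i).comp (measurable_pi_apply i)).trans ?_
  exact Finset.prod_congr rfl fun i _ => (measurePreserving_eval μ i).lintegral_comp (hf i)

lemma lintegral_bernoulliMeasure_bool (p : unitInterval) (f : Bool → ENNReal) :
    ∫⁻ b, f b ∂bernoulliMeasure true false p =
      ENNReal.ofReal p * f true + ENNReal.ofReal (1 - p) * f false := by
  rw [bernoulliMeasure_def, lintegral_add_measure, lintegral_smul_measure, lintegral_smul_measure,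
    lintegral_dirac, lintegral_dirac]
  have h1 : ENNReal.ofReal p = (unitInterval.toNNReal p : ENNReal) := by
    rw [ENNReal.ofReal_eq_coe_nnreal p.2.1]; rfl
  have h2 : ENNReal.ofReal (1 - p) = (unitInterval.toNNReal (unitInterval.symm p) : ENNReal) := by
    rw [ENNReal.ofReal_eq_coe_nnreal (sub_nonneg.2 p.2.2)]; rfl
  rw [h1, h2]; rfl

namespace ValueDist

variable (F : ValueDist)

instance : IsProbabilityMeasure F.law := F.isProbabilityMeasure

instance : NullSingletonClass F.law where
  measure_singleton x := by
    rw [← measure_cdf F.law, StieltjesFunction.measure_singleton,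
      leftLim_eq_of_tendsto
        (F.continuous_cdf.continuousAt.tendsto.mono_left nhdsWithin_le_nhds),
      sub_self, ENNReal.ofReal_zero]

lemma ae_nonneg : ∀ᵐ x ∂F.law, 0 ≤ x := by
  rw [ae_iff]
  convert F.nonneg using 2
  ext x; simp

lemma integrable_id : Integrable (fun x => x) F.law := by
  refine ⟨aestronglyMeasurable_id, ?_⟩
  rw [hasFiniteIntegral_iff_ofReal F.ae_nonneg]
  exact F.finite_mean.lt_top

/-- The probability that a value reaches the level `x`. -/
def tail (x : ℝ) : ℝ := F.law.real (Ici x)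

lemma tail_nonneg (x : ℝ) : 0 ≤ F.tail x := measureReal_nonneg

lemma tail_le_one (x : ℝ) : F.tail x ≤ 1 := measureReal_le_one

lemma tail_eq_Ioi (x : ℝ) : F.tail x = F.law.real (Ioi x) := by
  rw [tail, measureReal_def, measureReal_def, measure_congr Ioi_ae_eq_Ici]

lemma tail_eq_one_sub_cdf (x : ℝ) : F.tail x = 1 - cdf F.law x := by
  rw [tail_eq_Ioi, cdf_eq_real, ← compl_Iic, probReal_compl_eq_one_sub measurableSet_Iic]

lemma continuous_tail : Continuous F.tail := by
  simp_rw [funext F.tail_eq_one_sub_cdf]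
  exact continuous_const.sub F.continuous_cdf

lemma tail_of_nonpos {x : ℝ} (hx : x ≤ 0) : F.tail x = 1 := by
  rw [tail, measureReal_def, (prob_compl_eq_zero_iff measurableSet_Ici).1, ENNReal.toReal_one]
  rw [compl_Ici]
  exact measure_mono_null (Iio_subset_Iio hx) F.nonneg

lemma tendsto_tail : Tendsto F.tail atTop (𝓝 0) := by
  simp_rw [funext F.tail_eq_one_sub_cdf]
  simpa using (tendsto_cdf_atTop F.law).const_sub 1

/-- The expected value collected from one observed value with threshold `t`. -/
def reward (t : ℝ) : ℝ := ∫ x in Ici t, x ∂F.law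

lemma reward_nonneg (t : ℝ) : 0 ≤ F.reward t :=
  setIntegral_nonneg_of_ae F.ae_nonneg

lemma lintegral_ite_ofReal (t : ℝ) :
    ∫⁻ x, (if t ≤ x then ENNReal.ofReal x else 0) ∂F.law = ENNReal.ofReal (F.reward t) := by
  rw [reward, ofReal_integral_eq_lintegral_ofReal F.integrable_id.integrableOn
    (ae_restrict_of_ae F.ae_nonneg), ← lintegral_indicator measurableSet_Ici]
  rfl

end ValueDist

/-- The expected fraction of a selected value that is collected. -/
def yieldFactor (p ζ : unitInterval) : ℝ := 1 - p + p * ζ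

lemma yieldFactor_nonneg (p ζ : unitInterval) : 0 ≤ yieldFactor p ζ := by
  have := p.2.2
  have := mul_nonneg p.2.1 ζ.2.1
  rw [yieldFactor]; linarith

lemma yieldFactor_pos {p : unitInterval} (ζ : unitInterval) (hp : p < 1) : 0 < yieldFactor p ζ := by
  have : (p : ℝ) < 1 := hp
  have := mul_nonneg p.2.1 ζ.2.1
  rw [yieldFactor]; linarith

lemma prod_ite_lt_ite_eq {n : ℕ} {M : Type*} [CommMonoid M] (i : Fin n) (a : Fin n → M) (b : M) :
    (∏ j, if j < i then a j else if j = i then b else 1) = (∏ j ∈ Finset.Iio i, a j) * b := by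
  have h : ∀ j, (if j < i then a j else if j = i then b else 1) =
      (if j < i then a j else 1) * (if j = i then b else 1) := by
    intro j
    by_cases h1 : j < i
    · simp [h1, h1.ne]
    · simp [h1]
  rw [Finset.prod_congr rfl fun j _ => h j, Finset.prod_mul_distrib, ← Finset.prod_filter,
    Finset.prod_ite_eq' Finset.univ i, if_pos (Finset.mem_univ i)]
  congr 2
  ext j; simp

open Classical in
/-- The factor contributed by position `j` to the gain from position `i`. -/
def gainFactor {n : ℕ} (ζ : unitInterval) (τ : Fin n → ℝ) (i j : Fin n) (a : ℝ) (b : Bool) :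
    ENNReal :=
  if j < i then (if τ j ≤ a ∧ b = true then 0 else 1)
  else if j = i then
    (if b = true then ENNReal.ofReal ζ else 1) * (if τ i ≤ a then ENNReal.ofReal a else 0)
  else 1

lemma measurable_gainFactor {n : ℕ} (ζ : unitInterval) (τ : Fin n → ℝ) (i j : Fin n) (b : Bool) :
    Measurable fun a => gainFactor ζ τ i j a b := by
  unfold gainFactor
  split_ifs
  · refine Measurable.ite ?_ measurable_const measurable_const
    exact measurableSet_Ici.inter (MeasurableSet.const _)
  · exact (Measurable.ite measurableSet_Ici ENNReal.measurable_ofReal measurable_const).const_mul _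
  · exact (Measurable.ite measurableSet_Ici ENNReal.measurable_ofReal measurable_const).const_mul _
  · exact measurable_const

lemma measurable_uncurry_gainFactor {n : ℕ} (ζ : unitInterval) (τ : Fin n → ℝ) (i j : Fin n) :
    Measurable fun q : ℝ × Bool => gainFactor ζ τ i j q.1 q.2 :=
  measurable_from_prod_countable_left fun b => measurable_gainFactor ζ τ i j b

-- Being observed at i is a product of conditions on single earlier positions, so each gain splits
-- into one-coordinate factors and independence applies.
open Classical in
lemma ofReal_payoff_eq {n : ℕ} (ζ : unitInterval) (τ x : Fin n → ℝ) (y : Fin n → Bool)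
    (hx : ∀ i, 0 ≤ x i) :
    ENNReal.ofReal (payoff ζ τ x y) = ∑ i, ∏ j, gainFactor ζ τ i j (x j) (y j) := by
  rw [payoff, ENNReal.ofReal_sum_of_nonneg]
  · refine Finset.sum_congr rfl fun i _ => ?_
    have h1 : (∏ j, gainFactor ζ τ i j (x j) (y j)) =
        (∏ j ∈ Finset.Iio i, if τ j ≤ x j ∧ y j = true then 0 else 1) *
          ((if y i = true then ENNReal.ofReal ζ else 1) *
            (if τ i ≤ x i then ENNReal.ofReal (x i) else 0)) := by
      rw [← prod_ite_lt_ite_eq]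
      refine Finset.prod_congr rfl fun j _ => ?_
      unfold gainFactor
      split_ifs <;> simp_all
    rw [h1]
    by_cases ho : Observed τ x y i
    · rw [Finset.prod_eq_one fun j hj => if_neg (ho j (Finset.mem_Iio.1 hj)), one_mul]
      by_cases ht : τ i ≤ x i
      · simp only [ho, ht, and_self, if_true]
        split_ifs
        · exact ENNReal.ofReal_mul ζ.2.1
        · simp
      · simp [ht]
    · rw [if_neg (by tauto), ENNReal.ofReal_zero]
      simp only [Observed, not_forall, not_not] at ho
      obtain ⟨j, hj, hj'⟩ := ho
      have hz : (∏ j ∈ Finset.Iio i, if τ j ≤ x j ∧ y j = true then (0 : ENNReal) else 1) = 0 :=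
        Finset.prod_eq_zero (Finset.mem_Iio.2 hj) (if_pos hj')
      rw [hz, zero_mul]
  · intro i _
    split_ifs
    · exact mul_nonneg ζ.2.1 (hx i)
    · exact hx i
    · exact le_rfl

instance (n : ℕ) (F : ValueDist) : IsProbabilityMeasure (valuesLaw n F) := by
  unfold valuesLaw; infer_instance

instance (n : ℕ) (p : unitInterval) : IsProbabilityMeasure (disruptionLaw n p) := by
  unfold disruptionLaw; infer_instance

lemma ae_valuesLaw_nonneg (n : ℕ) (F : ValueDist) : ∀ᵐ x ∂valuesLaw n F, ∀ i, 0 ≤ x i := by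
  rw [ae_all_iff]
  intro i
  exact (measurePreserving_eval (fun _ : Fin n => F.law) i).quasiMeasurePreserving.ae F.ae_nonneg

open Classical in
lemma lintegral_gainFactor {n : ℕ} (p ζ : unitInterval) (F : ValueDist) (τ : Fin n → ℝ)
    (i j : Fin n) :
    ∫⁻ a, ∫⁻ b, gainFactor ζ τ i j a b ∂bernoulliMeasure true false p ∂F.law =
      if j < i then ENNReal.ofReal (1 - p * F.tail (τ j)) else if j = i then
        ENNReal.ofReal (yieldFactor p ζ * F.reward (τ i)) else 1 := by
  have hp := p.2.1
  have hp' : 0 ≤ 1 - (p : ℝ) := sub_nonneg.2 p.2.2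
  simp_rw [lintegral_bernoulliMeasure_bool]
  by_cases h1 : j < i
  · simp only [gainFactor, h1, if_true, and_true, Bool.false_eq_true, and_false, if_false, mul_one]
    have h2 : ∀ a, (if τ j ≤ a then (0 : ENNReal) else 1) = (Iio (τ j)).indicator 1 a := by
      intro a
      by_cases h : τ j ≤ a <;> simp [h, not_le.1]
    simp_rw [h2]
    rw [lintegral_add_right _ measurable_const, lintegral_const_mul _
      (measurable_one.indicator measurableSet_Iio), lintegral_indicator_one measurableSet_Iio,
      lintegral_const, measure_univ, mul_one, ← compl_Ici, ← ofReal_measureReal,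
      probReal_compl_eq_one_sub measurableSet_Ici, ← ENNReal.ofReal_mul hp,
      ← ENNReal.ofReal_add (mul_nonneg hp (sub_nonneg.2 measureReal_le_one)) hp']
    congr 1
    rw [ValueDist.tail]; ring
  by_cases h2 : j = i
  · simp only [gainFactor, h2, lt_irrefl, if_true, if_false, Bool.false_eq_true, one_mul]
    simp_rw [← mul_assoc, ← add_mul]
    rw [lintegral_const_mul _ (Measurable.ite measurableSet_Ici ENNReal.measurable_ofReal
      measurable_const), F.lintegral_ite_ofReal, ← ENNReal.ofReal_mul hp,
      ← ENNReal.ofReal_add (mul_nonneg hp ζ.2.1) hp', ← ENNReal.ofReal_mul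
      (add_nonneg (mul_nonneg hp ζ.2.1) hp')]
    congr 2
    rw [yieldFactor]; ring
  · simp only [gainFactor, h1, h2, if_false, mul_one]
    rw [lintegral_const, measure_univ, mul_one, ← ENNReal.ofReal_add hp hp']
    simp

lemma algValue_eq {n : ℕ} (p ζ : unitInterval) (F : ValueDist) (τ : Fin n → ℝ) :
    algValue n p ζ F τ = ENNReal.ofReal (yieldFactor p ζ *
      ∑ i, (∏ j ∈ Finset.Iio i, (1 - p * F.tail (τ j))) * F.reward (τ i)) := by
  have hm : ∀ i j : Fin n, Measurable fun ω : (Fin n → ℝ) × (Fin n → Bool) =>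
      gainFactor ζ τ i j (ω.1 j) (ω.2 j) := fun i j =>
    (measurable_uncurry_gainFactor ζ τ i j).comp
      (f := fun ω : (Fin n → ℝ) × (Fin n → Bool) => (ω.1 j, ω.2 j))
      (((measurable_pi_apply j).comp measurable_fst).prodMk
        ((measurable_pi_apply j).comp measurable_snd))
  have hf : ∀ j, 0 ≤ 1 - (p : ℝ) * F.tail (τ j) := fun j =>
    sub_nonneg.2 (mul_le_one₀ p.2.2 (F.tail_nonneg _) (F.tail_le_one _))
  have hy := yieldFactor_nonneg p ζ
  have hae : ∀ᵐ ω ∂(valuesLaw n F).prod (disruptionLaw n p), ∀ i, 0 ≤ ω.1 i :=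
    Measure.quasiMeasurePreserving_fst.ae (ae_valuesLaw_nonneg n F)
  rw [algValue, lintegral_congr_ae (hae.mono fun ω hω => ofReal_payoff_eq ζ τ ω.1 ω.2 hω),
    lintegral_finsetSum _ fun i _ => Finset.measurable_prod _ fun j _ => hm i j,
    Finset.mul_sum, ENNReal.ofReal_sum_of_nonneg]
  · refine Finset.sum_congr rfl fun i _ => ?_
    rw [lintegral_prod _ (Finset.measurable_prod _ fun j _ => hm i j).aemeasurable]
    simp only [disruptionLaw, valuesLaw]
    simp_rw [fun x : Fin n → ℝ => lintegral_pi_prod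
      (fun _ : Fin n => bernoulliMeasure true false p)
      (f := fun j b => gainFactor ζ τ i j (x j) b) fun j => measurable_of_countable _]
    rw [lintegral_pi_prod (fun _ : Fin n => F.law)
      (f := fun j a => ∫⁻ b, gainFactor ζ τ i j a b ∂bernoulliMeasure true false p)
      fun j => (measurable_uncurry_gainFactor ζ τ i j).lintegral_prod_right']
    simp_rw [lintegral_gainFactor]
    rw [prod_ite_lt_ite_eq, ← ENNReal.ofReal_prod_of_nonneg fun j _ => hf j,
      ← ENNReal.ofReal_mul (Finset.prod_nonneg fun j _ => hf j)]
    congr 1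
    ring
  · exact fun i _ => mul_nonneg hy (mul_nonneg (Finset.prod_nonneg fun j _ => hf j)
      (F.reward_nonneg _))

/-! ### The clairvoyant benchmark -/

/-- The fraction of the value in position `r` that is collected when the `d`-th selection is
disrupted. -/
def positionWeight (ζ : unitInterval) (d r : ℕ) : ℝ :=
  if r + 1 < d then 1 else if r + 1 = d then (ζ : ℝ) else 0

lemma positionWeight_nonneg (ζ : unitInterval) (d r : ℕ) : 0 ≤ positionWeight ζ d r := by
  have := ζ.2.1
  unfold positionWeight
  split_ifs <;> simp_all

lemma positionWeight_antitone (ζ : unitInterval) (d : ℕ) : Antitone (positionWeight ζ d) := by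
  have h0 := ζ.2.1
  have h1 := ζ.2.2
  intro r s h
  unfold positionWeight
  split_ifs <;> first | omega | linarith

/-- The number of values that exceed the `i`-th one. -/
def rankOf {n : ℕ} (x : Fin n → ℝ) (i : Fin n) : ℕ := (Finset.univ.filter fun j => x i < x j).card

lemma orderedPayoff_eq {n : ℕ} (ζ : unitInterval) (x : Fin n → ℝ) (d : ℕ)
    (σ : Equiv.Perm (Fin n)) :
    orderedPayoff ζ x d σ = ∑ i : Fin n, positionWeight ζ d i * x (σ i) := by
  unfold orderedPayoff positionWeight
  refine Finset.sum_congr rfl fun i _ => ?_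
  split_ifs <;> simp

/-- By the rearrangement inequality no order beats the decreasing one. -/
lemma orderedPayoff_le {n : ℕ} (ζ : unitInterval) (x : Fin n → ℝ) (d : ℕ)
    (σ : Equiv.Perm (Fin n)) (hx : ∀ i, 0 ≤ x i) :
    orderedPayoff ζ x d σ ≤ ∑ i, x i * positionWeight ζ d (rankOf x i) := by
  let ρ : Equiv.Perm (Fin n) := Tuple.sort fun i => -x i
  have hρ : Antitone (x ∘ ρ) := fun i j h =>
    neg_le_neg_iff.1 (Tuple.monotone_sort (fun i => -x i) h)
  have hw : Antitone fun i : Fin n => positionWeight ζ d i := fun i j h =>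
    positionWeight_antitone ζ d h
  -- Only strictly larger values count, so ties can only lower the rank and raise the weight; the
  -- bound needs no almost-sure distinctness.
  have hrank : ∀ i, rankOf x (ρ i) ≤ i := by
    intro i
    rw [← Fin.card_Iio i, rankOf]
    refine Finset.card_le_card_of_injOn ρ.symm (fun j hj => ?_) ρ.symm.injective.injOn
    have hj' : x (ρ i) < x j := by simpa using hj
    rw [Finset.mem_coe, Finset.mem_Iio]
    by_contra! hc
    have := hρ hc
    simp only [Function.comp, Equiv.apply_symm_apply] at this
    exact absurd hj' (not_lt.2 this)
  calc orderedPayoff ζ x d σ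
      = ∑ i : Fin n, positionWeight ζ d i * (x ∘ ρ) ((ρ.symm * σ : Equiv.Perm (Fin n)) i) := by
        rw [orderedPayoff_eq]
        simp [Equiv.Perm.mul_apply]
    _ ≤ ∑ i : Fin n, positionWeight ζ d i * (x ∘ ρ) i :=
        (hw.monovary hρ).sum_mul_comp_perm_le_sum_mul
    _ ≤ ∑ i : Fin n, x (ρ i) * positionWeight ζ d (rankOf x (ρ i)) := by
        refine Finset.sum_le_sum fun i _ => ?_
        rw [Function.comp, mul_comm]
        exact mul_le_mul_of_nonneg_left (positionWeight_antitone ζ d (hrank i)) (hx _)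
    _ = ∑ i, x i * positionWeight ζ d (rankOf x i) :=
        Equiv.sum_comp ρ fun i => x i * positionWeight ζ d (rankOf x i)

/-- Here k = D - 1: position r is kept in full when D > r + 1, with probability (1 - p)^(r+1), and
in the fraction ζ when D = r + 1, with probability p (1 - p)^r. -/
lemma hasSum_geometric_positionWeight {p : unitInterval} (ζ : unitInterval) (hp : p ≠ 0) (r : ℕ) :
    HasSum (fun k : ℕ => (1 - p : ℝ) ^ k * p * positionWeight ζ (k + 1) r)
      (yieldFactor p ζ * (1 - p) ^ r) := by
  have h := (hasSum_one_geometricMeasure hp).mul_left ((1 - p : ℝ) ^ (r + 1))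
  have h2 : HasSum (fun k : ℕ => (1 - p : ℝ) ^ (k + (r + 1)) * p *
      positionWeight ζ (k + (r + 1) + 1) r) ((1 - p : ℝ) ^ (r + 1) * 1) := by
    convert! h using 2 with k
    rw [positionWeight, if_pos (by omega), pow_add]
    ring
  rw [hasSum_nat_add_iff (f := fun k : ℕ => (1 - p : ℝ) ^ k * p * positionWeight ζ (k + 1) r),
    Finset.sum_range_succ, Finset.sum_eq_zero] at h2
  · convert! h2 using 1
    simp only [positionWeight, lt_irrefl, if_true, if_false, yieldFactor]
    ring
  · intro k hk
    rw [Finset.mem_range] at hk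
    rw [positionWeight, if_neg (by omega), if_neg (by omega), mul_zero]

lemma lintegral_positionWeight {p : unitInterval} (ζ : unitInterval) (hp : p ≠ 0) (r : ℕ) :
    ∫⁻ k, ENNReal.ofReal (positionWeight ζ (k + 1) r) ∂geometricMeasure p =
      ENNReal.ofReal (yieldFactor p ζ * (1 - p) ^ r) := by
  have h := hasSum_geometric_positionWeight ζ hp r
  rw [geometricMeasure_eq hp, lintegral_sum_measure, ← h.tsum_eq,
    ENNReal.ofReal_tsum_of_nonneg (fun k => mul_nonneg (geometricMeasure_nonneg p k)
      (positionWeight_nonneg _ _ _)) h.summable]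
  refine tsum_congr fun k => ?_
  rw [lintegral_smul_measure, lintegral_dirac, smul_eq_mul,
    ← ENNReal.ofReal_mul (geometricMeasure_nonneg p k)]

lemma measurable_rankOf {n : ℕ} (i : Fin n) : Measurable fun x : Fin n → ℝ => rankOf x i := by
  simp only [rankOf, Finset.card_filter]
  refine Finset.measurable_sum _ fun j _ => ?_
  exact Measurable.ite (measurableSet_lt (measurable_pi_apply i) (measurable_pi_apply j))
    measurable_const measurable_const

lemma lintegral_ite_lt (p : unitInterval) (F : ValueDist) (a : ℝ) :
    ∫⁻ b, (if a < b then ENNReal.ofReal (1 - p) else 1) ∂F.law =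
      ENNReal.ofReal (1 - p * F.tail a) := by
  have hp' : 0 ≤ 1 - (p : ℝ) := sub_nonneg.2 p.2.2
  have h : ∀ b, (if a < b then ENNReal.ofReal (1 - p) else 1) =
      (Ioi a).indicator (fun _ => ENNReal.ofReal (1 - p)) b +
        (Iic a).indicator (fun _ => 1) b := by
    intro b
    by_cases hb : a < b
    · simp [hb]
    · simp [hb, not_lt.1 hb]
  simp_rw [h]
  rw [lintegral_add_left (measurable_const.indicator measurableSet_Ioi),
    lintegral_indicator_const measurableSet_Ioi, lintegral_indicator_const measurableSet_Iic,
    ← ofReal_measureReal, ← ofReal_measureReal, ← ENNReal.ofReal_mul hp', one_mul,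
    ← ENNReal.ofReal_add (mul_nonneg hp' measureReal_nonneg) measureReal_nonneg,
    F.tail_eq_Ioi, ← compl_Ioi, probReal_compl_eq_one_sub measurableSet_Ioi]
  congr 1
  ring

lemma ofReal_pow_rankOf {m : ℕ} (p : unitInterval) (x : Fin (m + 1) → ℝ) (i : Fin (m + 1)) :
    ENNReal.ofReal ((1 - p) ^ rankOf x i) =
      ∏ j, if x i < x (i.succAbove j) then ENNReal.ofReal (1 - p) else 1 := by
  have hp' : 0 ≤ 1 - (p : ℝ) := sub_nonneg.2 p.2.2
  have h := Fin.prod_univ_succAbove (fun j => if x i < x j then ENNReal.ofReal (1 - p) else 1) i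
  rw [if_neg (lt_irrefl _), one_mul] at h
  rw [← h, rankOf, ENNReal.ofReal_pow hp', ← Finset.prod_const, Finset.prod_filter]

/-- Conditionally on the i-th value being a, each of the other m values exceeds a with probability
S(a) and then costs a factor 1 - p. -/
lemma lintegral_pow_rankOf {m : ℕ} (p : unitInterval) (F : ValueDist) (i : Fin (m + 1)) :
    ∫⁻ x, ENNReal.ofReal (x i) * ENNReal.ofReal ((1 - p) ^ rankOf x i) ∂valuesLaw (m + 1) F =
      ∫⁻ a, ENNReal.ofReal a * ENNReal.ofReal (1 - p * F.tail a) ^ m ∂F.law := by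
  simp_rw [ofReal_pow_rankOf]
  have hmp := measurePreserving_piFinSuccAbove (fun _ : Fin (m + 1) => F.law) i
  have hmeas : Measurable fun q : ℝ × (Fin m → ℝ) => ENNReal.ofReal q.1 *
      ∏ j, if q.1 < q.2 j then ENNReal.ofReal (1 - p) else 1 := by
    refine (ENNReal.measurable_ofReal.comp measurable_fst).mul
      (Finset.measurable_prod _ fun j _ => ?_)
    exact Measurable.ite (measurableSet_lt measurable_fst
      ((measurable_pi_apply j).comp measurable_snd)) measurable_const measurable_const
  refine (hmp.lintegral_comp hmeas).trans ?_
  rw [lintegral_prod _ hmeas.aemeasurable]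
  refine lintegral_congr fun a => ?_
  simp only
  rw [lintegral_const_mul' _ _ ENNReal.ofReal_ne_top, lintegral_pi_prod (fun _ : Fin m => F.law)
    (f := fun _ b => if a < b then ENNReal.ofReal (1 - p) else 1)
    fun _ => Measurable.ite measurableSet_Ioi measurable_const measurable_const]
  simp_rw [lintegral_ite_lt]
  rw [Finset.prod_const, Finset.card_univ, Fintype.card_fin]

/-- The clairvoyant value in terms of a single value and its quantile. -/
lemma optValue_le {m : ℕ} {p : unitInterval} (ζ : unitInterval) (F : ValueDist) (hp : p ≠ 0) :
    optValue (m + 1) p ζ F ≤ ENNReal.ofReal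
      (yieldFactor p ζ * ((m + 1) * ∫ a, a * (1 - p * F.tail a) ^ m ∂F.law)) := by
  have hc := yieldFactor_nonneg p ζ
  have hf : ∀ a, 0 ≤ 1 - (p : ℝ) * F.tail a := fun a =>
    sub_nonneg.2 (mul_le_one₀ p.2.2 (F.tail_nonneg _) (F.tail_le_one _))
  have hf1 : ∀ a, 1 - (p : ℝ) * F.tail a ≤ 1 := fun a =>
    sub_le_self _ (mul_nonneg p.2.1 (F.tail_nonneg _))
  have hae : ∀ᵐ ω ∂(valuesLaw (m + 1) F).prod (geometricMeasure p), ∀ i, 0 ≤ ω.1 i :=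
    Measure.quasiMeasurePreserving_fst.ae (ae_valuesLaw_nonneg (m + 1) F)
  have hmr : ∀ i : Fin (m + 1), Measurable fun ω : (Fin (m + 1) → ℝ) × ℕ =>
      ENNReal.ofReal (ω.1 i) * ENNReal.ofReal (positionWeight ζ (ω.2 + 1) (rankOf ω.1 i)) := by
    intro i
    refine measurable_from_prod_countable_left fun k => ?_
    exact (ENNReal.measurable_ofReal.comp (measurable_pi_apply i)).mul
      ((measurable_from_nat (f := fun r => ENNReal.ofReal (positionWeight ζ (k + 1) r))).comp
        (measurable_rankOf i))
  have hint : Integrable (fun a => a * (1 - p * F.tail a) ^ m) F.law := by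
    refine F.integrable_id.mul_bdd (c := 1) ?_ (ae_of_all _ fun a => ?_)
    · exact ((continuous_const.sub
        (continuous_const.mul F.continuous_tail)).pow m).aestronglyMeasurable
    · rw [Real.norm_of_nonneg (pow_nonneg (hf a) m)]
      exact pow_le_one₀ (hf a) (hf1 a)
  calc optValue (m + 1) p ζ F
      ≤ ∫⁻ ω, ∑ i, ENNReal.ofReal (ω.1 i) *
          ENNReal.ofReal (positionWeight ζ (ω.2 + 1) (rankOf ω.1 i))
          ∂(valuesLaw (m + 1) F).prod (geometricMeasure p) := by
        refine lintegral_mono_ae (hae.mono fun ω hω => iSup_le fun σ => ?_)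
        refine (ENNReal.ofReal_le_ofReal (orderedPayoff_le ζ ω.1 (ω.2 + 1) σ hω)).trans ?_
        rw [ENNReal.ofReal_sum_of_nonneg fun i _ =>
          mul_nonneg (hω i) (positionWeight_nonneg _ _ _)]
        exact Finset.sum_le_sum fun i _ => (ENNReal.ofReal_mul (hω i)).le
    _ = ∑ i : Fin (m + 1), ENNReal.ofReal (yieldFactor p ζ) *
          ∫⁻ x, ENNReal.ofReal (x i) * ENNReal.ofReal ((1 - p) ^ rankOf x i)
            ∂valuesLaw (m + 1) F := by
        rw [lintegral_finsetSum _ fun i _ => hmr i]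
        refine Finset.sum_congr rfl fun i _ => ?_
        rw [lintegral_prod _ (hmr i).aemeasurable, ← lintegral_const_mul' _ _ ENNReal.ofReal_ne_top]
        refine lintegral_congr fun x => ?_
        simp only
        rw [lintegral_const_mul' _ _ ENNReal.ofReal_ne_top, lintegral_positionWeight ζ hp,
          ENNReal.ofReal_mul hc]
        ring
    _ = _ := by
        simp_rw [lintegral_pow_rankOf]
        rw [Finset.sum_const, Finset.card_univ, Fintype.card_fin, nsmul_eq_mul,
          ENNReal.ofReal_mul hc, ENNReal.ofReal_mul (by positivity),
          ofReal_integral_eq_lintegral_ofReal hint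
            (F.ae_nonneg.mono fun a ha => mul_nonneg ha (pow_nonneg (hf a) m))]
        have h1 : ∫⁻ a, ENNReal.ofReal a * ENNReal.ofReal (1 - p * F.tail a) ^ m ∂F.law =
            ∫⁻ a, ENNReal.ofReal (a * (1 - p * F.tail a) ^ m) ∂F.law := by
          refine lintegral_congr_ae (F.ae_nonneg.mono fun a ha => ?_)
          simp only
          rw [ENNReal.ofReal_mul ha, ENNReal.ofReal_pow (hf a)]
        have h2 : ENNReal.ofReal ((m : ℝ) + 1) = ((m + 1 : ℕ) : ENNReal) := by
          rw [← ENNReal.ofReal_natCast]; push_cast; rfl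
        rw [h1, h2]
        ring

/-! ### Quantile levels -/

namespace ValueDist

variable (F : ValueDist)

/-- For q < 1 the set has a least element by continuity of the tail, and it lies in the half-line
starting there. -/
lemma measureReal_tail_le {q : ℝ} (hq : 0 ≤ q) : F.law.real {x | F.tail x ≤ q} ≤ q := by
  rcases le_or_gt 1 q with h1 | h1
  · exact measureReal_le_one.trans h1
  rcases eq_empty_or_nonempty {x | F.tail x ≤ q} with h | h
  · rw [h, measureReal_empty]; exact hq
  have hbdd : BddBelow {x | F.tail x ≤ q} := by
    refine ⟨0, fun x hx => ?_⟩
    by_contra! hc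
    rw [mem_ofPred_eq, F.tail_of_nonpos hc.le] at hx
    linarith
  have hmem := (isClosed_le F.continuous_tail continuous_const).csInf_mem h hbdd
  calc F.law.real {x | F.tail x ≤ q} ≤ F.law.real (Ici (sInf {x | F.tail x ≤ q})) :=
        measureReal_mono fun x hx => csInf_le hbdd hx
    _ ≤ q := hmem

/-- The smallest non-negative level whose tail probability, scaled by `p`, is at most `u`. -/
def level (p u : ℝ) : ℝ := sInf {x | 0 ≤ x ∧ p * F.tail x ≤ u}

variable {F} {p u : ℝ}

lemma bddBelow_level : BddBelow {x | 0 ≤ x ∧ p * F.tail x ≤ u} := ⟨0, fun _ hx => hx.1⟩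

lemma level_nonneg : 0 ≤ F.level p u := Real.sInf_nonneg fun _ hx => hx.1

lemma nonempty_level (hu : 0 < u) : {x | 0 ≤ x ∧ p * F.tail x ≤ u}.Nonempty := by
  have h : Tendsto (fun x => p * F.tail x) atTop (𝓝 0) := by
    simpa using F.tendsto_tail.const_mul p
  obtain ⟨x, hx, hx'⟩ := ((eventually_ge_atTop 0).and (h.eventually_le_const hu)).exists
  exact ⟨x, hx, hx'⟩

lemma mul_tail_level_le (hu : 0 < u) : p * F.tail (F.level p u) ≤ u :=
  ((isClosed_le continuous_const continuous_id).inter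
    (isClosed_le (continuous_const.mul F.continuous_tail) continuous_const)).csInf_mem
    (nonempty_level hu) bddBelow_level |>.2

/-- Non-negative points to the left of a positive level violate the constraint, so continuity forces
equality at the level. -/
lemma level_eq_zero_or (hu : 0 < u) : F.level p u = 0 ∨ p * F.tail (F.level p u) = u := by
  rcases level_nonneg (F := F) (p := p) (u := u) |>.eq_or_lt with h | h
  · exact Or.inl h.symm
  refine Or.inr (le_antisymm (mul_tail_level_le hu) ?_)
  have hlim : Tendsto (fun x => p * F.tail x) (𝓝[<] F.level p u)
      (𝓝 (p * F.tail (F.level p u))) :=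
    (continuous_const.mul F.continuous_tail).continuousAt.tendsto.mono_left nhdsWithin_le_nhds
  refine ge_of_tendsto hlim ?_
  filter_upwards [Ioo_mem_nhdsLT h] with x hx
  by_contra! hc
  exact absurd (csInf_le bddBelow_level ⟨hx.1.le, hc.le⟩) (not_le.2 hx.2)

lemma level_anti {v : ℝ} (hu : 0 < u) (huv : u ≤ v) : F.level p v ≤ F.level p u :=
  csInf_le_csInf bddBelow_level (nonempty_level hu) fun _ hx => ⟨hx.1, hx.2.trans huv⟩

end ValueDist

/-! ### Slices of the discount -/

/-- The discount `exp (-p S(x) / h)` of a value `x` with tail probability `S(x)`. -/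
def discount (F : ValueDist) (p h x : ℝ) : ℝ := Real.exp (-(p * F.tail x / h))

variable {F : ValueDist} {p h : ℝ}

lemma continuous_discount : Continuous (discount F p h) :=
  Real.continuous_exp.comp ((continuous_const.mul F.continuous_tail).div_const h).neg

lemma discount_pos (x : ℝ) : 0 < discount F p h x := Real.exp_pos _

lemma discount_le_one (hp : 0 < p) (hh : 0 < h) (x : ℝ) : discount F p h x ≤ 1 :=
  Real.exp_le_one_iff.2 (neg_nonpos.2 (div_nonneg (mul_nonneg hp.le (F.tail_nonneg x)) hh.le))

/-- The slice of the discount between the levels `a` and `b`. -/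
def slice (F : ValueDist) (p h a b x : ℝ) : ℝ := min (discount F p h x) b - min (discount F p h x) a

lemma slice_nonneg {a b : ℝ} (hab : a ≤ b) (x : ℝ) : 0 ≤ slice F p h a b x :=
  sub_nonneg.2 (min_le_min_left _ hab)

lemma slice_le {a b : ℝ} (hab : a ≤ b) (x : ℝ) : slice F p h a b x ≤ b - a := by
  rw [slice]
  rcases le_total (discount F p h x) a with h1 | h1
  · rw [min_eq_left h1, min_eq_left (h1.trans hab)]; linarith
  · rw [min_eq_right h1]; linarith [min_le_right (discount F p h x) b]

lemma continuous_slice (a b : ℝ) : Continuous (slice F p h a b) :=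
  (continuous_discount.min continuous_const).sub (continuous_discount.min continuous_const)

lemma integrable_slice {a b : ℝ} (hab : a ≤ b) : Integrable (slice F p h a b) F.law := by
  refine Integrable.of_bound (continuous_slice a b).aestronglyMeasurable (b - a)
    (ae_of_all _ fun x => ?_)
  rw [Real.norm_of_nonneg (slice_nonneg hab x)]
  exact slice_le hab x

lemma measureReal_le_discount_le (hp : 0 < p) (hh : 0 < h) {y : ℝ} (hy : y ∈ Ioc (0 : ℝ) 1) :
    F.law.real {x | y ≤ discount F p h x} ≤ h / p * -Real.log y := by
  have h0 : 0 ≤ h / p * -Real.log y :=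
    mul_nonneg (div_pos hh hp).le (neg_nonneg.2 (Real.log_nonpos hy.1.le hy.2))
  refine le_trans (measureReal_mono fun x hx => ?_) (F.measureReal_tail_le h0)
  rw [mem_ofPred_eq, discount, ← Real.log_le_iff_le_exp hy.1] at hx
  rw [mem_ofPred_eq, div_mul_eq_mul_div, le_div_iff₀ hp]
  have : p * F.tail x / h ≤ -Real.log y := by linarith
  rw [div_le_iff₀ hh] at this
  linarith

lemma integral_neg_log (a b : ℝ) :
    ∫ y in a..b, -Real.log y = entropyDrift b - entropyDrift a := by
  rw [intervalIntegral.integral_neg, integral_log, entropyDrift, entropyDrift]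
  ring

/-- Layer cake: a slice reaches t > 0 only if the discount reaches a + t, which has probability at
most -(h/p) ln(a + t). Integrating the logarithm is what produces G. -/
lemma integral_slice_le (hp : 0 < p) (hh : 0 < h) {a b : ℝ} (ha : 0 ≤ a) (hab : a ≤ b)
    (hb : b ≤ 1) :
    ∫ x, slice F p h a b x ∂F.law ≤ h / p * (entropyDrift b - entropyDrift a) := by
  rw [(integrable_slice hab).integral_eq_integral_Ioc_meas_le
    (ae_of_all _ fun x => slice_nonneg hab x) (ae_of_all _ fun x => slice_le hab x)]
  have hint : IntervalIntegrable (fun t => h / p * -Real.log (t + a)) volume 0 (b - a) := by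
    have : IntervalIntegrable (fun t => Real.log t) volume (0 + a) (b - a + a) :=
      intervalIntegral.intervalIntegrable_log'
    exact ((this.comp_add_right (c := a)).neg).const_mul _ |> fun h => by simpa using h
  have hle : ∫ t in Ioc 0 (b - a), F.law.real {x | t ≤ slice F p h a b x} ≤
      ∫ t in Ioc 0 (b - a), h / p * -Real.log (t + a) := by
    refine integral_mono_of_nonneg (ae_of_all _ fun t => measureReal_nonneg)
      ((intervalIntegrable_iff_integrableOn_Ioc_of_le (by linarith)).1 hint) ?_
    refine (ae_restrict_iff' measurableSet_Ioc).2 (ae_of_all _ fun t ht => ?_)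
    refine le_trans (measureReal_mono fun x hx => ?_)
      (measureReal_le_discount_le (F := F) hp hh (y := t + a)
        ⟨by linarith [ht.1], by linarith [ht.2]⟩)
    rw [mem_ofPred_eq, slice] at hx
    rw [mem_ofPred_eq]
    rcases le_total (discount F p h x) a with h1 | h1
    · rw [min_eq_left h1, min_eq_left (h1.trans hab)] at hx; linarith [ht.1]
    · rw [min_eq_right h1] at hx; linarith [min_le_left (discount F p h x) b]
  refine hle.trans (le_of_eq ?_)
  rw [← intervalIntegral.integral_of_le (by linarith), intervalIntegral.integral_const_mul,
    intervalIntegral.integral_comp_add_right (fun t => -Real.log t), integral_neg_log]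
  simp

/-- A threshold whose selection probability matches the mean of a slice collects at least what
the slice does. -/
lemma integral_mul_slice_le {a b t : ℝ} (hab : a ≤ b) (ht : 0 ≤ t)
    (hslice : t = 0 ∨ ∫ x, slice F p h a b x ∂F.law ≤ (b - a) * F.tail t) :
    ∫ x, x * slice F p h a b x ∂F.law ≤ (b - a) * F.reward t := by
  have hi1 : Integrable (fun x => x * slice F p h a b x) F.law := by
    refine F.integrable_id.mul_bdd (c := b - a) (continuous_slice a b).aestronglyMeasurable
      (ae_of_all _ fun x => ?_)
    rw [Real.norm_of_nonneg (slice_nonneg hab x)]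
    exact slice_le hab x
  have hi2 : Integrable ((Ici t).indicator fun x => x) F.law :=
    F.integrable_id.indicator measurableSet_Ici
  have hi3 : Integrable ((Ici t).indicator fun _ => (1 : ℝ)) F.law :=
    (integrable_const 1).indicator measurableSet_Ici
  have hi4 := integrable_slice (F := F) (p := p) (h := h) hab
  have hi5 : Integrable (fun x => t * (slice F p h a b x -
      (b - a) * (Ici t).indicator (fun _ => (1 : ℝ)) x)) F.law :=
    (hi4.sub (hi3.const_mul (b - a))).const_mul t
  -- This is (x - t)(slice - (b - a) 1[x ≥ t]) ≤ 0, with t as Lagrange multiplier for the mean; the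
  -- multiplier term vanishes if t = 0.
  have hpt : ∀ᵐ x ∂F.law, x * slice F p h a b x ≤
      (b - a) * (Ici t).indicator (fun x => x) x +
        t * (slice F p h a b x - (b - a) * (Ici t).indicator (fun _ => (1 : ℝ)) x) := by
    filter_upwards [F.ae_nonneg] with x hx
    have h1 := slice_nonneg (F := F) (p := p) (h := h) hab x
    have h2 := slice_le (F := F) (p := p) (h := h) hab x
    by_cases hxt : t ≤ x
    · rw [indicator_of_mem (mem_Ici.2 hxt), indicator_of_mem (mem_Ici.2 hxt)]
      nlinarith [mul_nonneg (sub_nonneg.2 hxt) (sub_nonneg.2 h2)]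
    · rw [indicator_of_notMem (by simpa using hxt), indicator_of_notMem (by simpa using hxt)]
      nlinarith [mul_nonneg (sub_nonneg.2 (not_le.1 hxt).le) h1]
  have hmono := integral_mono_ae hi1
    ((hi2.const_mul (b - a)).add hi5) hpt
  have heval : ∫ x, ((b - a) * (Ici t).indicator (fun x => x) x +
        t * (slice F p h a b x - (b - a) * (Ici t).indicator (fun _ => (1 : ℝ)) x)) ∂F.law =
      (b - a) * F.reward t + t * (∫ x, slice F p h a b x ∂F.law - (b - a) * F.tail t) := by
    rw [integral_add (hi2.const_mul _) hi5,
      integral_const_mul, integral_const_mul, integral_sub hi4 (hi3.const_mul _),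
      integral_const_mul, integral_indicator measurableSet_Ici,
      integral_indicator measurableSet_Ici, setIntegral_const, smul_eq_mul, mul_one]
    rfl
  refine (hmono.trans_eq heval).trans ?_
  rcases hslice with rfl | hs
  · simp
  · nlinarith [mul_nonneg ht (sub_nonneg.2 hs)]

/-! ### The Euler thresholds against the discount -/

/-- The thresholds read off the Euler scheme. -/
def eulerThreshold (F : ValueDist) (p h β : ℝ) (k : ℕ) : ℝ :=
  -- After absorption the slope would be 0/0; the threshold 0 keeps the sequence decreasing.
  if eulerSeq h β k = 0 then 0 else F.level p (eulerQuantile h β k)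

variable {β : ℝ}

lemma eulerThreshold_nonneg (k : ℕ) : 0 ≤ eulerThreshold F p h β k := by
  unfold eulerThreshold
  split_ifs
  · exact le_rfl
  · exact ValueDist.level_nonneg

lemma eulerThreshold_antitone (hh : 0 < h) (hβ : 1 < β) :
    Antitone (eulerThreshold F p h β) := by
  refine antitone_nat_of_succ_le fun k => ?_
  by_cases h1 : eulerSeq h β (k + 1) = 0
  · rw [eulerThreshold, if_pos h1]
    exact eulerThreshold_nonneg k
  have hpos : 0 < eulerSeq h β (k + 1) := lt_of_le_of_ne (eulerSeq_nonneg _) (Ne.symm h1)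
  have hpos' := hpos.trans_le (eulerSeq_antitone hh hβ (Nat.le_succ k))
  rw [eulerThreshold, if_neg h1, eulerThreshold, if_neg hpos'.ne']
  exact ValueDist.level_anti (eulerQuantile_pos hh hβ hpos') (eulerQuantile_le_succ hh hβ hpos)

/-- Each gap shrinks by at least the factor 1 - q_k, while survival shrinks by 1 - p S(τ_k) ≥ 1 -
q_k. The start is d_0 ≤ hβ because G(1) = 1. -/
lemma eulerSeq_gap_le_prod (hp1 : p ≤ 1) (hh : 0 < h) (hβ : 1 < β) (k : ℕ) :
    eulerSeq h β k - eulerSeq h β (k + 1) ≤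
      h * β * ∏ j ∈ Finset.range k, (1 - p * F.tail (eulerThreshold F p h β j)) := by
  have hf : ∀ j, 0 ≤ 1 - p * F.tail (eulerThreshold F p h β j) := fun j =>
    sub_nonneg.2 (mul_le_one₀ hp1 (F.tail_nonneg _) (F.tail_le_one _))
  induction k with
  | zero =>
    have := eulerSeq_sub_succ_le (h := h) (β := β) 0
    simp only [eulerSeq, entropyDrift_one] at this ⊢
    simpa using this
  | succ k ih =>
    rcases (eulerSeq_nonneg (h := h) (β := β) (k + 1)).eq_or_lt with h0 | h0
    · have h1 : eulerSeq h β (k + 1) - eulerSeq h β (k + 1 + 1) ≤ 0 := by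
        linarith [eulerSeq_nonneg (h := h) (β := β) (k + 1 + 1)]
      refine h1.trans (mul_nonneg (mul_nonneg hh.le (by linarith))
        (Finset.prod_nonneg fun j _ => hf j))
    have hk : 0 < eulerSeq h β k := h0.trans_le (eulerSeq_antitone hh hβ (Nat.le_succ k))
    have hgap : 0 ≤ eulerSeq h β k - eulerSeq h β (k + 1) :=
      sub_nonneg.2 (eulerSeq_antitone hh hβ (Nat.le_succ k))
    have htail : p * F.tail (eulerThreshold F p h β k) ≤ eulerQuantile h β k := by
      rw [eulerThreshold, if_neg hk.ne']
      exact ValueDist.mul_tail_level_le (eulerQuantile_pos hh hβ hk)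
    have hstep := eulerSeq_gap_succ_le (h := h) (β := β) h0
    rw [← eulerQuantile_mul hh hβ hk] at hstep
    rw [Finset.prod_range_succ, ← mul_assoc]
    nlinarith [mul_le_mul_of_nonneg_right ih (hf k), mul_le_mul_of_nonneg_right htail hgap]

lemma integral_mul_discount_le (hp : 0 < p) (hp1 : p ≤ 1) (hh : 0 < h) (hβ : 1 < β) {n : ℕ}
    (hn : eulerSeq h β n = 0) :
    ∫ x, x * discount F p h x ∂F.law ≤
      h * β * ∑ k ∈ Finset.range n,
        (∏ j ∈ Finset.range k, (1 - p * F.tail (eulerThreshold F p h β j))) *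
          F.reward (eulerThreshold F p h β k) := by
  have hanti := eulerSeq_antitone hh hβ
  -- The slices telescope from y_0 = 1 to y_n = 0, which is where absorption is needed.
  have htel : ∀ x, x * discount F p h x = ∑ k ∈ Finset.range n,
      x * slice F p h (eulerSeq h β (k + 1)) (eulerSeq h β k) x := by
    intro x
    simp only [slice]
    rw [← Finset.mul_sum, Finset.sum_range_sub' fun k => min (discount F p h x) (eulerSeq h β k),
      hn, min_eq_right (discount_pos x).le]
    rw [eulerSeq, min_eq_left (discount_le_one hp hh x), sub_zero]
  simp_rw [htel]
  rw [integral_finsetSum, Finset.mul_sum]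
  · refine Finset.sum_le_sum fun k _ => ?_
    have hgap := hanti (Nat.le_succ k)
    have hmem := eulerSeq_mem_Icc hh hβ
    refine (integral_mul_slice_le hgap (eulerThreshold_nonneg k) ?_).trans
      ((mul_le_mul_of_nonneg_right (eulerSeq_gap_le_prod hp1 hh hβ k)
        (F.reward_nonneg _)).trans_eq (mul_assoc _ _ _))
    rcases (eulerSeq_nonneg (h := h) (β := β) k).eq_or_lt with h0 | h0
    · exact Or.inl (by rw [eulerThreshold, if_pos h0.symm])
    have hq := eulerQuantile_pos hh hβ h0
    rw [eulerThreshold, if_neg h0.ne']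
    refine (ValueDist.level_eq_zero_or hq).imp_right fun he => ?_
    refine (integral_slice_le hp hh (hmem (k + 1)).1 hgap (hmem k).2).trans (le_of_eq ?_)
    have hm := eulerQuantile_mul hh hβ h0
    rw [← he] at hm
    rw [div_mul_eq_mul_div, ← hm]
    field_simp
  · intro k _
    have hgap := hanti (Nat.le_succ k)
    refine F.integrable_id.mul_bdd (c := eulerSeq h β k - eulerSeq h β (k + 1))
      (continuous_slice _ _).aestronglyMeasurable (ae_of_all _ fun x => ?_)
    rw [Real.norm_of_nonneg (slice_nonneg hgap x)]
    exact slice_le hgap x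

lemma integrable_mul_discount (hp : 0 < p) (hh : 0 < h) :
    Integrable (fun x => x * discount F p h x) F.law := by
  refine F.integrable_id.mul_bdd (c := 1) continuous_discount.aestronglyMeasurable
    (ae_of_all _ fun x => ?_)
  rw [Real.norm_of_nonneg (discount_pos x).le]
  exact discount_le_one hp hh x

lemma integral_mul_discount_pos (hp : 0 < p) (hh : 0 < h) :
    0 < ∫ x, x * discount F p h x ∂F.law := by
  rw [integral_pos_iff_support_of_nonneg_ae
    (F.ae_nonneg.mono fun x hx => mul_nonneg hx (discount_pos x).le)
    (integrable_mul_discount hp hh)]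
  have hs : Function.support (fun x => x * discount F p h x) = {0}ᶜ := by
    ext x
    simp [(discount_pos x).ne']
  rw [hs, (prob_compl_eq_one_iff (measurableSet_singleton 0)).2 (measure_singleton 0)]
  exact one_pos

/-! ### The competitive ratio and its limit -/

/-- The adaptive algorithm for `N + 1` values with the thresholds of the Euler scheme of
step `1 / N`. -/
def eulerAlg (p : unitInterval) {β : ℝ} (hβ : 1 < β) (N : ℕ) (hN : 0 < N) :
    AdaptiveAlg (N + 1) where
  threshold F k := eulerThreshold F p (1 / N) β k
  antitone F _ _ hij := eulerThreshold_antitone (by positivity) hβ hij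

lemma prod_Iio_fin {n : ℕ} (i : Fin n) (f : ℕ → ℝ) :
    ∏ j ∈ Finset.Iio i, f j = ∏ j ∈ Finset.range i, f j := by
  rw [← Nat.Iio_eq_range, ← Fin.map_valEmbedding_Iio, Finset.prod_map]
  rfl

lemma pow_le_discount (F : ValueDist) (p : unitInterval) {N : ℕ} (x : ℝ) :
    (1 - p * F.tail x) ^ N ≤ discount F p (1 / N) x := by
  have h0 : 0 ≤ 1 - (p : ℝ) * F.tail x :=
    sub_nonneg.2 (mul_le_one₀ p.2.2 (F.tail_nonneg _) (F.tail_le_one _))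
  refine (pow_le_pow_left₀ h0 (Real.one_sub_le_exp_neg _) N).trans (le_of_eq ?_)
  rw [← Real.exp_nat_mul, discount]
  congr 1
  rw [div_div_eq_mul_div, div_one]
  ring

/-- With N + 1 values the benchmark has exponent N, matching the step 1/N. The loss N/(N + 1) is the
quotient of exponent and number of values. -/
lemma adaptiveRatio_succ_ge {β : ℝ} (hβ : SolvesHillKertz β) {p : unitInterval}
    (ζ : unitInterval) (hp : 0 < p) (hp1 : p < 1) {N : ℕ} (hN : 0 < N) :
    ENNReal.ofReal ((N / (N + 1)) * (1 / β)) ≤ adaptiveRatio (N + 1) p ζ := by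
  have h1 := hβ.one_lt
  have hp' : (0 : ℝ) < p := hp
  have hh : (0 : ℝ) < 1 / N := by positivity
  refine le_iSup_of_le (eulerAlg p h1 N hN) (le_iInf fun F => ?_)
  have hc := yieldFactor_pos ζ hp1
  have hzero : eulerSeq (1 / N) β (N + 1) = 0 := le_antisymm
    ((eulerSeq_antitone hh h1 (Nat.le_succ N)).trans (eulerSeq_eq_zero hβ hN).le)
    (eulerSeq_nonneg _)
  have hkey := integral_mul_discount_le (F := F) hp' p.2.2 hh h1 hzero
  have hpos := integral_mul_discount_pos (F := F) hp' hh
  set S := ∑ k ∈ Finset.range (N + 1),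
    (∏ j ∈ Finset.range k, (1 - p * F.tail (eulerThreshold F p (1 / N) β j))) *
      F.reward (eulerThreshold F p (1 / N) β k) with hS
  have halg : algValue (N + 1) p ζ F ((eulerAlg p h1 N hN).threshold F) =
      ENNReal.ofReal (yieldFactor p ζ * S) := by
    rw [algValue_eq, hS, ← Fin.sum_univ_eq_sum_range fun k =>
      (∏ j ∈ Finset.range k, (1 - p * F.tail (eulerThreshold F p (1 / N) β j))) *
        F.reward (eulerThreshold F p (1 / N) β k)]
    congr 2
    refine Finset.sum_congr rfl fun i _ => ?_
    rw [← prod_Iio_fin i fun j => 1 - p * F.tail (eulerThreshold F p (1 / N) β j)]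
    rfl
  have hSpos : 0 < S := pos_of_mul_pos_right (hpos.trans_le hkey) (by positivity)
  have hopt := optValue_le (m := N) ζ F hp.ne'
  have hmono : ∫ a, a * (1 - p * F.tail a) ^ N ∂F.law ≤ 1 / N * β * S := by
    refine le_trans (integral_mono_of_nonneg ?_ (integrable_mul_discount hp' hh) ?_) hkey
    · exact F.ae_nonneg.mono fun a ha => mul_nonneg ha (pow_nonneg (sub_nonneg.2
        (mul_le_one₀ p.2.2 (F.tail_nonneg _) (F.tail_le_one _))) N)
    · exact F.ae_nonneg.mono fun a ha => mul_le_mul_of_nonneg_left (pow_le_discount F p a) ha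
  -- The benchmark is bounded only from above here, so the division is justified by a nonzero
  -- numerator and a finite denominator.
  have halg0 : algValue (N + 1) p ζ F ((eulerAlg p h1 N hN).threshold F) ≠ 0 := by
    rw [halg]
    exact (ENNReal.ofReal_pos.2 (mul_pos hc hSpos)).ne'
  rw [ENNReal.le_div_iff_mul_le (Or.inr halg0) (Or.inl (ne_top_of_le_ne_top
    ENNReal.ofReal_ne_top hopt)), halg]
  refine (mul_le_mul_right hopt _).trans ?_
  rw [← ENNReal.ofReal_mul (by positivity)]
  refine ENNReal.ofReal_le_ofReal ?_
  have hN' : (0 : ℝ) < N := by positivity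
  have hβ0 : 0 < β := by linarith
  calc (N : ℝ) / (N + 1) * (1 / β) *
        (yieldFactor p ζ * ((N + 1) * ∫ a, a * (1 - p * F.tail a) ^ N ∂F.law))
      ≤ (N : ℝ) / (N + 1) * (1 / β) *
        (yieldFactor p ζ * ((N + 1) * (1 / N * β * S))) := by gcongr
    _ = yieldFactor p ζ * S := by field_simp

lemma le_liminf_adaptiveRatio {β : ℝ} (hβ : SolvesHillKertz β) {p : unitInterval}
    (ζ : unitInterval) (hp : 0 < p) (hp1 : p < 1) :
    ENNReal.ofReal (1 / β) ≤ liminf (fun n : ℕ => adaptiveRatio n p ζ) atTop := by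
  rw [← liminf_nat_add _ 1]
  have hlim : Tendsto (fun N : ℕ => ENNReal.ofReal (((N : ℝ) / (N + 1)) * (1 / β))) atTop
      (𝓝 (ENNReal.ofReal (1 / β))) := by
    refine (ENNReal.continuous_ofReal.tendsto _).comp ?_
    simpa using (tendsto_natCast_div_add_atTop (1 : ℝ)).mul_const (1 / β)
  rw [← hlim.liminf_eq]
  refine liminf_le_liminf ?_
  filter_upwards [eventually_gt_atTop 0] with N hN using adaptiveRatio_succ_ge hβ ζ hp hp1 hN

end OSUD

end

theorem theorem2 :
    ∃ θ : ℝ, 0 < θ ∧ |θ - 0.745| < 0.0005 ∧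
      OSUD.SolvesHillKertz (1 / θ) ∧ (∀ β : ℝ, OSUD.SolvesHillKertz β → β = 1 / θ) ∧
      ∀ p ζ : unitInterval, 0 < p → p < 1 →
        ENNReal.ofReal θ ≤
          Filter.liminf (fun n : ℕ => OSUD.adaptiveRatio n p ζ) Filter.atTop := by
  obtain ⟨β, hmem, hβ⟩ := OSUD.exists_solvesHillKertz_mem
  have hpos : 0 < β := zero_lt_one.trans hβ.one_lt
  have hinv : 1 / (1 / β) = β := one_div_one_div β
  refine ⟨1 / β, by positivity, ?_, hinv.symm ▸ hβ, fun γ hγ => ?_, fun p ζ hp hp1 =>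
    OSUD.le_liminf_adaptiveRatio hβ ζ hp hp1⟩
  · have h1 : (0.7445 : ℝ) < 1 / β := by
      rw [lt_div_iff₀ hpos]
      linarith [hmem.2]
    have h2 : 1 / β < 0.7455 := by
      rw [div_lt_iff₀ hpos]
      linarith [hmem.1]
    rw [abs_lt]
    constructor <;> linarith
  · rw [hinv]
    exact hγ.unique hβ
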